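/- Let $q$ be a prime power. For subspaces $U,W$ of $\mathbb{F}_q^v$ let $d_i(U,W)=\dim(U+W)-\min\{\dim U,\dim W\}$ be the injection distance. A full flag in $\mathbb{F}_q^v$ is a chain $\Lambda=(W_1,\dots,W_{v-1})$ of subspaces $\{0\}<W_1<\dots<W_{v-1}<\mathbb{F}_q^v$ with $\dim W_i=i$ for all $i$. The Grassmann distance of two full flags $\Lambda=(W_1,\dots,W_{v-1})$ and $\Lambda'=(W_1',\dots,W_{v-1}')$ is $d_G(\Lambda,\Lambda')=\sum_{i=1}^{v-1} d_i(W_i,W_i')=\sum_{i=1}^{v-1}\bigl(i-\dim(W_i\cap W_i')\bigr)$. Let $A_q^f(v,d)$ denote the maximum cardinality of a set $\mathcal{C}$ of full flags in $\mathbb{F}_q^v$ with $d_G(\Lambda,\Lambda')\ge d$ for all distinct $\Lambda,\Lambda'\in\mathcal{C}$. Then for each integer $k\ge 1$ $$A_q^f(2k,k^2)=q^k+1,$$ and for each integer $k\ge 2$ $$A_q^f(2k+1,k^2+k)=q^{k+1}+1.$$ -/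

import Mathlib

/-- Injection distance of two subspaces: `dim (U + W) - min (dim U) (dim W)`. The subtraction
never truncates in a finite-dimensional space. -/
noncomputable def injectionDist {F V : Type*} [Field F] [AddCommGroup V] [Module F V]
    (U W : Submodule F V) : ℕ :=
  Module.finrank F ↥(U ⊔ W) - min (Module.finrank F ↥U) (Module.finrank F ↥W)

/-- A flag `{0} < W₁ < ⋯ < W_m < F^v` of length `m` in `F^v`. -/
@[ext]
structure VFlag (F : Type*) [Field F] (v m : ℕ) where
  W : Fin m → Submodule F (Fin v → F)
  strictMono : StrictMono W
  bot_lt : ∀ i, ⊥ < W i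
  lt_top : ∀ i, W i < ⊤

namespace VFlag

/-- The type of a flag: the set of the dimensions of its members. -/
noncomputable def type {F : Type*} [Field F] {v m : ℕ} (L : VFlag F v m) : Finset ℕ :=
  Finset.univ.image fun i => Module.finrank F ↥(L.W i)

/-- The Grassmann distance of two flags of the same length. -/
noncomputable def grassmannDist {F : Type*} [Field F] {v m : ℕ} (L L' : VFlag F v m) : ℕ :=
  ∑ i, injectionDist (L.W i) (L'.W i)

end VFlag

/-- The set of all flags of type `T` in `F^v`. Dimensions increase strictly along a flag, so a
flag of type `T` has exactly `#T` members. -/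
def flagsOfType (F : Type*) [Field F] (v : ℕ) (T : Finset ℕ) : Set (VFlag F v T.card) :=
  {L | L.type = T}

/-- The minimum distance of a set of flags: the minimum of the Grassmann distance over all pairs of
distinct elements (`∞` if there are fewer than two elements). -/
noncomputable def minGrassmannDist {F : Type*} [Field F] {v m : ℕ} (C : Set (VFlag F v m)) : ℕ∞ :=
  ⨅ (L ∈ C) (L' ∈ C) (_ : L ≠ L'), (L.grassmannDist L' : ℕ∞)

/-- The cardinalities of the flag codes of type `T` in `F^v` with minimum distance at least `d`. -/
def flagCodeSizes (F : Type*) [Field F] (v d : ℕ) (T : Finset ℕ) : Set ℕ :=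
  {n | ∃ C : Set (VFlag F v T.card),
    C ⊆ flagsOfType F v T ∧ (d : ℕ∞) ≤ minGrassmannDist C ∧ C.ncard = n}

/-- `A_q^f(v, d; T)`: the maximum cardinality of a flag code of type `T` in `F^v` with minimum
distance at least `d` (a genuine maximum over a finite field, see `isGreatest_maxFlagCode`). -/
noncomputable def maxFlagCode (F : Type*) [Field F] (v d : ℕ) (T : Finset ℕ) : ℕ :=
  sSup (flagCodeSizes F v d T)

/-- `A_q^f(v, d)`: the case of full flags, of type `{1, …, v - 1}`. -/
noncomputable def maxFullFlagCode (F : Type*) [Field F] (v d : ℕ) : ℕ :=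
  maxFlagCode F v d (Finset.Ico 1 v)

theorem finite_vflag (F : Type*) [Field F] [Finite F] (v m : ℕ) : Finite (VFlag F v m) :=
  Finite.of_injective VFlag.W fun _ _ h => VFlag.ext h

theorem isGreatest_maxFlagCode (F : Type*) [Field F] [Finite F] (v d : ℕ) (T : Finset ℕ) :
    IsGreatest (flagCodeSizes F v d T) (maxFlagCode F v d T) := by
  have := finite_vflag F v T.card
  have hb : BddAbove (flagCodeSizes F v d T) := by
    refine ⟨Nat.card (VFlag F v T.card), ?_⟩
    rintro n ⟨C, -, -, rfl⟩
    rw [← Set.ncard_univ]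
    exact Set.ncard_le_ncard (Set.subset_univ C) Set.finite_univ
  have hn : (flagCodeSizes F v d T).Nonempty :=
    ⟨0, ∅, Set.empty_subset _, by simp [minGrassmannDist], by simp⟩
  exact ⟨Nat.sSup_mem hn hb, fun n h => le_csSup hb h⟩

/-! Two `i`-dimensional subspaces of `F^v` are at injection distance at most `min i (v - i)`, and
these bounds sum to `k ^ 2` for `v = 2k` and to `k ^ 2 + k` for `v = 2k + 1`. The prescribed
distance is thus the largest possible: it is attained exactly when members of equal dimension meet
trivially up to `v / 2` and span the space from `v / 2` on.

Upper bound: the `k`-dimensional members form a partial spread. For `v = 2k`, counting nonzero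
vectors bounds its size. For `v = 2k + 1`, counting inside a hyperplane
(`card_filter_le_hyperplane`) limits how many members it contains, and a double count over
hyperplanes finishes.

Lower bound: only the members of dimensions `k` and `v - k` matter, since disjointness passes to
smaller spaces and codisjointness to larger ones (`card_mem_flagCodeSizes`). For `v = 2k` the
Desarguesian spread of `K × K` works. For `v = 2k + 1`, multiplication maps of `K` are restricted to
an `F`-hyperplane `T` of `K`, and their graphs in `T × K` are enlarged by one vector. -/

open Module

/-! ### Chains of subspaces -/

section Chains

variable {F V : Type*} [Field F] [AddCommGroup V] [Module F V] [FiniteDimensional F V]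

theorem Submodule.exists_le_le_finrank_eq_min {A B : Submodule F V} (h : A ≤ B) :
    ∃ A' : Submodule F V, A ≤ A' ∧ A' ≤ B ∧ finrank F A' = min (finrank F A + 1) (finrank F B) := by
  rcases h.eq_or_lt with rfl | hlt
  · exact ⟨A, le_rfl, le_rfl, by omega⟩
  · obtain ⟨x, hxB, hxA⟩ := SetLike.exists_of_lt hlt
    have hle : A ⊔ F ∙ x ≤ B := sup_le h ((Submodule.span_singleton_le_iff_mem _ _).2 hxB)
    refine ⟨A ⊔ F ∙ x, le_sup_left, hle, ?_⟩
    have hx : x ≠ 0 := fun h0 => hxA (h0 ▸ A.zero_mem)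
    have h1 := Submodule.finrank_sup_add_finrank_inf_eq A (F ∙ x)
    rw [finrank_span_singleton hx] at h1
    have h2 : finrank F A < finrank F ↥(A ⊔ F ∙ x) := by
      refine Submodule.finrank_lt_finrank_of_lt (lt_of_le_of_ne le_sup_left fun he => hxA ?_)
      rw [he]
      exact Submodule.mem_sup_right (Submodule.mem_span_singleton_self x)
    have h3 := Submodule.finrank_mono hle
    omega

theorem Submodule.exists_monotone_chain {A B : Submodule F V} (h : A ≤ B) :
    ∃ W : ℕ → Submodule F V, Monotone W ∧ (∀ i, A ≤ W i) ∧ (∀ i, W i ≤ B) ∧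
      ∀ i, finrank F (W i) = min (finrank F A + i) (finrank F B) := by
  choose f hf1 hf2 hf3 using fun A' : {A' : Submodule F V // A' ≤ B} =>
    Submodule.exists_le_le_finrank_eq_min A'.2
  let W : ℕ → {A' : Submodule F V // A' ≤ B} := fun i => (fun A' => ⟨f A', hf2 A'⟩)^[i] ⟨A, h⟩
  have hW : ∀ i, W (i + 1) = ⟨f (W i), hf2 (W i)⟩ := fun i => Function.iterate_succ_apply' _ _ _
  have hmono : Monotone fun i => (W i : Submodule F V) :=
    monotone_nat_of_le_succ fun i => by simpa only [hW i] using hf1 (W i)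
  refine ⟨fun i => W i, hmono, fun i => hmono (Nat.zero_le i), fun i => (W i).2, fun i => ?_⟩
  induction i with
  | zero =>
    have := Submodule.finrank_mono h
    change finrank F A = _
    omega
  | succ i ih =>
    have hs := hf3 (W i)
    change finrank F (W i : Submodule F V) = _ at ih
    change finrank F (W (i + 1) : Submodule F V) = _
    rw [hW i]
    change finrank F (f (W i)) = _
    omega

/-- A pair `U ≤ X` of dimensions `k`, `m` with `m ≤ k + 1` extends to a complete chain. -/
theorem Submodule.exists_chain_through {U X : Submodule F V} (h : U ≤ X)
    (hm : finrank F X ≤ finrank F U + 1) :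
    ∃ W : ℕ → Submodule F V, Monotone W ∧ (∀ i ≤ finrank F U, W i ≤ U) ∧
      (∀ i, finrank F U < i → X ≤ W i) ∧ ∀ i ≤ finrank F V, finrank F (W i) = i := by
  obtain ⟨W₁, hm₁, -, hu₁, hf₁⟩ := Submodule.exists_monotone_chain (bot_le : ⊥ ≤ U)
  obtain ⟨W₂, hm₂, hl₂, -, hf₂⟩ := Submodule.exists_monotone_chain (le_top : X ≤ ⊤)
  -- In the second branch `i ≥ finrank F U + 1 ≥ finrank F X`, so the subtraction does not truncate
  -- and the dimension is `i`.
  refine ⟨fun i => if i ≤ finrank F U then W₁ i else W₂ (i - finrank F X), ?_, ?_, ?_, ?_⟩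
  · intro i j hij
    dsimp only
    split_ifs with hi hj
    · exact hm₁ hij
    · exact (hu₁ i).trans (h.trans (hl₂ _))
    · omega
    · exact hm₂ (by omega)
  · intro i hi
    simpa [hi] using hu₁ i
  · intro i hi
    simpa [not_le.2 hi] using hl₂ _
  · intro i hi
    beta_reduce
    by_cases hiU : i ≤ finrank F U
    · rw [if_pos hiU, hf₁, finrank_bot]
      omega
    · rw [if_neg hiU, hf₂, finrank_top]
      omega

end Chains

/-! ### The maximum Grassmann distance -/

section Distance

/-- From `k` to `k + 1`, the sum gains a zero at each end and each of the `2k + 1` old terms grows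
by one. -/
theorem sum_min_sub_even (k : ℕ) :
    ∑ i ∈ Finset.range (2 * k + 1), min i (2 * k - i) = k ^ 2 := by
  induction k with
  | zero => simp
  | succ k ih =>
    rw [show 2 * (k + 1) + 1 = (2 * k + 1) + 1 + 1 by ring, Finset.sum_range_succ,
      Finset.sum_range_succ']
    have : ∀ i ∈ Finset.range (2 * k + 1), min (i + 1) (2 * (k + 1) - (i + 1))
        = min i (2 * k - i) + 1 := fun i hi => by
      rw [Finset.mem_range] at hi
      omega
    rw [Finset.sum_congr rfl this, Finset.sum_add_distrib, ih]
    simp only [Finset.sum_const, Finset.card_range, smul_eq_mul, mul_one]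
    rw [show min (2 * k + 1 + 1) (2 * (k + 1) - (2 * k + 1 + 1)) = 0 by omega,
      show min 0 (2 * (k + 1) - 0) = 0 by omega]
    ring

theorem sum_min_sub_odd (k : ℕ) :
    ∑ i ∈ Finset.range (2 * k + 2), min i (2 * k + 1 - i) = k ^ 2 + k := by
  induction k with
  | zero => simp [Finset.sum_range_succ]
  | succ k ih =>
    rw [show 2 * (k + 1) + 2 = (2 * k + 2) + 1 + 1 by ring, Finset.sum_range_succ,
      Finset.sum_range_succ']
    have : ∀ i ∈ Finset.range (2 * k + 2), min (i + 1) (2 * (k + 1) + 1 - (i + 1))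
        = min i (2 * k + 1 - i) + 1 := fun i hi => by
      rw [Finset.mem_range] at hi
      omega
    rw [Finset.sum_congr rfl this, Finset.sum_add_distrib, ih]
    simp only [Finset.sum_const, Finset.card_range, smul_eq_mul, mul_one]
    rw [show min (2 * k + 2 + 1) (2 * (k + 1) + 1 - (2 * k + 2 + 1)) = 0 by omega,
      show min 0 (2 * (k + 1) + 1 - 0) = 0 by omega]
    ring

theorem sum_fin_card_Ico_min (v : ℕ) :
    ∑ i : Fin (Finset.Ico 1 v).card, min ((i : ℕ) + 1) (v - (i + 1))
      = ∑ i ∈ Finset.range (v + 1), min i (v - i) := by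
  rw [Fin.sum_univ_eq_sum_range (fun i => min (i + 1) (v - (i + 1))), Nat.card_Ico]
  rcases v with - | v
  · simp
  · rw [Finset.sum_range_succ, Finset.sum_range_succ']
    simp

variable {F : Type*} [Field F]

/-- The increasing enumeration of `{1, …, v - 1}` is unique. -/
theorem VFlag.finrank_eq_of_mem_flagsOfType {v : ℕ} {L : VFlag F v (Finset.Ico 1 v).card}
    (hL : L ∈ flagsOfType F v (Finset.Ico 1 v)) (i : Fin (Finset.Ico 1 v).card) :
    finrank F (L.W i) = i + 1 := by
  have h1 : (fun i => finrank F (L.W i)) = (Finset.Ico 1 v).orderEmbOfFin rfl := by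
    refine Finset.orderEmbOfFin_unique rfl (fun i => ?_)
      fun i j hij => Submodule.finrank_lt_finrank_of_lt (L.strictMono hij)
    have : finrank F (L.W i) ∈ L.type := Finset.mem_image_of_mem _ (Finset.mem_univ i)
    rwa [show L.type = Finset.Ico 1 v from hL] at this
  have h2 : (fun i : Fin (Finset.Ico 1 v).card => (i : ℕ) + 1)
      = (Finset.Ico 1 v).orderEmbOfFin rfl := by
    refine Finset.orderEmbOfFin_unique rfl (fun i => ?_) fun i j hij => by
      simpa using hij
    have := i.2.trans_eq (Nat.card_Ico 1 v)
    rw [Finset.mem_Ico]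
    omega
  exact congrFun (h1.trans h2.symm) i

theorem injectionDist_self {V : Type*} [AddCommGroup V] [Module F V] (A : Submodule F V) :
    injectionDist A A = 0 := by
  rw [injectionDist, sup_idem, min_self, Nat.sub_self]

theorem injectionDist_le {v d : ℕ} {A B : Submodule F (Fin v → F)} (hA : finrank F A = d)
    (hB : finrank F B = d) : injectionDist A B ≤ min d (v - d) := by
  have h1 := Submodule.finrank_sup_add_finrank_inf_eq A B
  have h2 := Submodule.finrank_le (A ⊔ B)
  rw [finrank_fin_fun] at h2
  unfold injectionDist
  omega

theorem disjoint_of_le_injectionDist {v d : ℕ} {A B : Submodule F (Fin v → F)}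
    (hA : finrank F A = d) (hB : finrank F B = d) (h : d ≤ injectionDist A B) :
    Disjoint A B := by
  have h1 := Submodule.finrank_sup_add_finrank_inf_eq A B
  unfold injectionDist at h
  rw [disjoint_iff, ← Submodule.finrank_eq_zero (R := F)]
  omega

theorem injectionDist_eq_of_disjoint {v d : ℕ} {A B : Submodule F (Fin v → F)}
    (hA : finrank F A = d) (hB : finrank F B = d) (h : Disjoint A B) : injectionDist A B = d := by
  have h1 := Submodule.finrank_sup_add_finrank_inf_eq A B
  rw [h.eq_bot, finrank_bot] at h1
  unfold injectionDist
  omega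

theorem injectionDist_eq_of_codisjoint {v d : ℕ} {A B : Submodule F (Fin v → F)}
    (hA : finrank F A = d) (hB : finrank F B = d) (h : Codisjoint A B) :
    injectionDist A B = v - d := by
  unfold injectionDist
  rw [h.eq_top, finrank_top, finrank_fin_fun]
  omega

/-- Two full flags at the maximum Grassmann distance have disjoint members in each dimension
`d ≤ v / 2`. -/
theorem VFlag.disjoint_of_le_grassmannDist {v : ℕ} {L L' : VFlag F v (Finset.Ico 1 v).card}
    (hL : L ∈ flagsOfType F v (Finset.Ico 1 v)) (hL' : L' ∈ flagsOfType F v (Finset.Ico 1 v))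
    (h : ∑ i ∈ Finset.range (v + 1), min i (v - i) ≤ L.grassmannDist L')
    (j : Fin (Finset.Ico 1 v).card) (hj : 2 * ((j : ℕ) + 1) ≤ v) : Disjoint (L.W j) (L'.W j) := by
  rw [← sum_fin_card_Ico_min] at h
  have hle : ∀ i ∈ Finset.univ, injectionDist (L.W i) (L'.W i)
      ≤ min ((i : ℕ) + 1) (v - (i + 1)) := fun i _ =>
    injectionDist_le (finrank_eq_of_mem_flagsOfType hL i) (finrank_eq_of_mem_flagsOfType hL' i)
  -- A sum that reaches the total of its termwise bounds reaches each of them.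
  have heq := (Finset.sum_eq_sum_iff_of_le hle).1 (le_antisymm (Finset.sum_le_sum hle) h) j
    (Finset.mem_univ j)
  refine disjoint_of_le_injectionDist (finrank_eq_of_mem_flagsOfType hL j)
    (finrank_eq_of_mem_flagsOfType hL' j) ?_
  omega

/-- Pairs `U a ≤ X a` of dimensions `k` and `v - k` in consecutive or equal dimensions, with the
`U a` pairwise disjoint and the `X a` pairwise codisjoint, extend to full flags at the maximum
distance from each other. -/
theorem card_mem_flagCodeSizes {ι : Type*} [Finite ι] {v : ℕ} (hv : 2 ≤ v)
    (U X : ι → Submodule F (Fin v → F)) (hUX : ∀ a, U a ≤ X a) {k : ℕ}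
    (hU : ∀ a, finrank F (U a) = k) (hX : ∀ a, finrank F (X a) ≤ k + 1) (hkv : v ≤ 2 * k + 1)
    (hkv' : 2 * k ≤ v)
    (hdisj : Pairwise fun a b => Disjoint (U a) (U b))
    (hcodisj : Pairwise fun a b => Codisjoint (X a) (X b)) :
    Nat.card ι ∈ flagCodeSizes F v (∑ i ∈ Finset.range (v + 1), min i (v - i))
      (Finset.Ico 1 v) := by
  choose W hmono hWU hXW hW using fun a =>
    Submodule.exists_chain_through (hUX a) ((hX a).trans (hU a ▸ le_rfl))
  simp only [hU, finrank_fin_fun] at hWU hXW hW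
  have hi : ∀ i : Fin (Finset.Ico 1 v).card, (i : ℕ) + 1 < v := fun i => by
    have := i.2.trans_eq (Nat.card_Ico 1 v)
    omega
  let L : ι → VFlag F v (Finset.Ico 1 v).card := fun a =>
    { W := fun i => W a (i + 1)
      strictMono := fun i j hij => by
        refine lt_of_le_of_ne (hmono a (by simpa using hij.le)) fun he => ?_
        have h1 := hW a _ (hi i).le
        rw [show W a (i + 1) = W a (j + 1) from he, hW a _ (hi j).le] at h1
        have : (i : ℕ) < j := hij
        omega
      bot_lt := fun i => by
        rw [bot_lt_iff_ne_bot]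
        intro he
        have h1 := hW a _ (hi i).le
        rw [he, finrank_bot] at h1
        omega
      lt_top := fun i => by
        rw [lt_top_iff_ne_top]
        intro he
        have h1 := hW a _ (hi i).le
        rw [he, finrank_top, finrank_fin_fun] at h1
        have := hi i
        omega }
  have hdist : ∀ a b, a ≠ b →
      (L a).grassmannDist (L b) = ∑ i ∈ Finset.range (v + 1), min i (v - i) := fun a b hab => by
    rw [← sum_fin_card_Ico_min]
    refine Finset.sum_congr rfl fun i _ => ?_
    change injectionDist (W a (i + 1)) (W b (i + 1)) = _
    by_cases hik : (i : ℕ) + 1 ≤ k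
    · rw [injectionDist_eq_of_disjoint (hW a _ (hi i).le) (hW b _ (hi i).le)
        ((hdisj hab).mono (hWU a _ hik) (hWU b _ hik))]
      omega
    · rw [injectionDist_eq_of_codisjoint (hW a _ (hi i).le) (hW b _ (hi i).le)
        ((hcodisj hab).mono (hXW a _ (by omega)) (hXW b _ (by omega)))]
      omega
  -- A flag is at distance 0 from itself, so a positive mutual distance makes `L` injective.
  have hpos : 0 < ∑ i ∈ Finset.range (v + 1), min i (v - i) :=
    Finset.sum_pos' (fun _ _ => Nat.zero_le _) ⟨1, by simp; omega, by omega⟩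
  have hinj : Function.Injective L := fun a b hab => by
    by_contra hne
    have h1 := hdist a b hne
    rw [← hab] at h1
    rw [← h1] at hpos
    simp [VFlag.grassmannDist, injectionDist_self] at hpos
  refine ⟨Set.range L, ?_, ?_, ?_⟩
  · rintro _ ⟨a, rfl⟩
    change Finset.univ.image (fun i : Fin _ => finrank F (W a (i + 1))) = _
    ext n
    simp only [Finset.mem_image, Finset.mem_univ, true_and, Finset.mem_Ico]
    constructor
    · rintro ⟨i, rfl⟩
      rw [hW a _ (hi i).le]
      exact ⟨by omega, hi i⟩
    · rintro ⟨h1, h2⟩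
      refine ⟨⟨n - 1, by rw [Nat.card_Ico]; omega⟩, ?_⟩
      rw [hW a _ (by simp only; omega)]
      simp only
      omega
  · refine le_iInf₂ fun _ ha => le_iInf₂ fun _ hb => le_iInf fun hne => ?_
    obtain ⟨a, rfl⟩ := ha
    obtain ⟨b, rfl⟩ := hb
    rw [hdist a b fun h => hne (h ▸ rfl)]
  · rw [← Set.image_univ, Set.ncard_image_of_injective _ hinj, Set.ncard_univ]

end Distance

/-! ### Bounds for partial spreads -/

section Counting

variable {F V : Type*} [Field F] [Finite F] [AddCommGroup V] [Module F V] [FiniteDimensional F V]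

theorem Submodule.natCard_ne_zero_subtype (H : Submodule F V) :
    Nat.card {x : H // x ≠ 0} = Nat.card F ^ finrank F H - 1 := by
  have : Finite H := Module.finite_of_finite F
  have : Fintype H := Fintype.ofFinite H
  classical
  rw [← Module.natCard_eq_pow_finrank, Nat.card_eq_fintype_card, Nat.card_eq_fintype_card,
    Fintype.card_subtype_compl, Fintype.card_subtype_eq]

/-- Pairwise disjoint subspaces of `H` share no nonzero vector. -/
theorem sum_pow_finrank_sub_one_le {ι : Type*} [Fintype ι] (U : ι → Submodule F V)
    (H : Submodule F V) (hU : ∀ i, U i ≤ H) (hdisj : Pairwise fun i j => Disjoint (U i) (U j)) :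
    ∑ i, (Nat.card F ^ finrank F (U i) - 1) ≤ Nat.card F ^ finrank F H - 1 := by
  have : Finite V := Module.finite_of_finite F
  simp_rw [← Submodule.natCard_ne_zero_subtype]
  rw [← Nat.card_sigma]
  let f : (Σ i, {x : U i // x ≠ 0}) → {x : H // x ≠ 0} := fun p =>
    ⟨⟨p.2.1, hU _ p.2.1.2⟩, fun h => p.2.2 (by simpa using h)⟩
  refine Nat.card_le_card_of_injective f ?_
  rintro ⟨i, ⟨x, hx⟩, hx0⟩ ⟨j, ⟨y, hy⟩, hy0⟩ h
  have hxy : x = y := by simpa [f] using h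
  subst hxy
  have hij : i = j := by
    by_contra hne
    exact hx0 (Subtype.ext (Submodule.disjoint_def.1 (hdisj hne) x hx hy))
  subst hij
  rfl

theorem natCard_le_of_pairwise_disjoint_even {ι : Type*} [Finite ι] {k : ℕ} (hk : 1 ≤ k)
    (hV : finrank F V = 2 * k) (U : ι → Submodule F V) (hU : ∀ i, finrank F (U i) = k)
    (hdisj : Pairwise fun i j => Disjoint (U i) (U j)) : Nat.card ι ≤ Nat.card F ^ k + 1 := by
  have := Fintype.ofFinite ι
  have h := sum_pow_finrank_sub_one_le U ⊤ (fun _ => le_top) hdisj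
  have hq : 1 < Nat.card F ^ k := Nat.one_lt_pow (by omega) Finite.one_lt_card
  simp only [hU, Finset.sum_const, Finset.card_univ, smul_eq_mul, finrank_top, hV] at h
  rw [← Nat.card_eq_fintype_card, mul_comm 2 k, pow_mul] at h
  obtain ⟨p, hp⟩ := Nat.exists_eq_add_of_lt hq
  rw [hp] at h ⊢
  have h2 : (1 + p + 1) ^ 2 - 1 = (p + 3) * (p + 1) := by
    rw [show (1 + p + 1) ^ 2 = (p + 3) * (p + 1) + 1 by ring]
    rfl
  rw [h2, show 1 + p + 1 - 1 = p + 1 by omega] at h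
  have := Nat.le_of_mul_le_mul_right h (by omega)
  omega

/-- In a partial spread of `k`-subspaces of a `2k + 1`-space with at least `q ^ (k + 1) + 2`
members, at most `q` members lie in a given hyperplane. -/
theorem card_filter_le_hyperplane {ι : Type*} [Fintype ι] {k : ℕ} (hk : 2 ≤ k)
    (hV : finrank F V = 2 * k + 1) (U : ι → Submodule F V) (hU : ∀ i, finrank F (U i) = k)
    (hdisj : Pairwise fun i j => Disjoint (U i) (U j))
    (hcard : Nat.card F ^ (k + 1) + 2 ≤ Fintype.card ι) (H : Submodule F V)
    (hH : finrank F H = 2 * k) [DecidablePred fun i => U i ≤ H] :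
    (Finset.univ.filter fun i => U i ≤ H).card ≤ Nat.card F := by
  set q := Nat.card F with hq
  have hq1 : 1 < q := Finite.one_lt_card
  have h := sum_pow_finrank_sub_one_le (fun i => U i ⊓ H) H (fun _ => inf_le_right)
    fun i j hij => (hdisj hij).mono inf_le_left inf_le_left
  rw [← hq, hH] at h
  -- A member outside `H` still meets the hyperplane in dimension at least `k - 1`.
  have hlow : ∀ i, (q ^ (k - 1) - 1) + (if U i ≤ H then q ^ k - q ^ (k - 1) else 0)
      ≤ q ^ finrank F ↥(U i ⊓ H) - 1 := fun i => by
    have hp : 1 ≤ q ^ (k - 1) := Nat.one_le_pow _ _ (by omega)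
    have hle : q ^ (k - 1) ≤ q ^ k := Nat.pow_le_pow_right (by omega) (by omega)
    split_ifs with hi
    · rw [inf_eq_left.2 hi, hU]
      omega
    · have h1 := Submodule.finrank_sup_add_finrank_inf_eq (U i) H
      have h2 := Submodule.finrank_le (U i ⊔ H)
      rw [hU, hH] at h1
      have : q ^ (k - 1) ≤ q ^ finrank F ↥(U i ⊓ H) :=
        Nat.pow_le_pow_right (by omega) (by omega)
      omega
  replace h := (Finset.sum_le_sum fun i _ => hlow i).trans h
  rw [Finset.sum_add_distrib, ← Finset.sum_filter] at h
  simp only [Finset.sum_const, Finset.card_univ, smul_eq_mul] at h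
  -- With `Q = q ^ (k - 1)`, at least `q + 1` members in `H` would give `(q²Q + 2)(Q - 1) + (q +
  -- 1)Q(q - 1) = q²Q² + Q - 2 ≤ q²Q² - 1`, so `Q ≤ 1`, contrary to `k ≥ 2`.
  by_contra! hx
  set x := (Finset.univ.filter fun i => U i ≤ H).card
  clear_value q
  clear hlow
  obtain ⟨r, rfl⟩ : ∃ r, k = r + 1 := ⟨k - 1, by omega⟩
  have hQ : 2 ≤ q ^ r := by
    calc 2 ≤ q := hq1
      _ = q ^ 1 := (pow_one q).symm
      _ ≤ q ^ r := Nat.pow_le_pow_right (by omega) (by omega)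
  have e1 : q ^ (r + 1) = q ^ r * q := pow_succ _ _
  have e2 : q ^ (r + 1 + 1) = q ^ r * q * q := by rw [pow_succ, pow_succ]
  have e3 : q ^ (2 * (r + 1)) = q ^ r * q * (q ^ r * q) := by ring
  rw [Nat.add_sub_cancel, e1, e3] at h
  rw [e2] at hcard
  generalize q ^ r = Q at *
  obtain ⟨s, rfl⟩ : ∃ s, q = s + 1 := ⟨q - 1, by omega⟩
  obtain ⟨t, rfl⟩ : ∃ t, Q = t + 2 := ⟨Q - 2, by omega⟩
  have f1 : (t + 2) * (s + 1) - (t + 2) = (t + 2) * s := by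
    rw [mul_add, mul_one, Nat.add_sub_cancel]
  rw [f1, show t + 2 - 1 = t + 1 by omega] at h
  have g1 := Nat.mul_le_mul_right (t + 1) hcard
  have g2 : (s + 2) * ((t + 2) * s) ≤ x * ((t + 2) * s) := Nat.mul_le_mul_right _ hx
  have g3 := (Nat.add_le_add g1 g2).trans h
  have g4 : 1 ≤ (t + 2) * (s + 1) * ((t + 2) * (s + 1)) := by nlinarith
  have g5 := (Nat.le_sub_iff_add_le g4).1 g3
  nlinarith

theorem natCard_le_of_pairwise_disjoint_odd {ι : Type*} [Finite ι] {k : ℕ} (hk : 2 ≤ k)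
    (hV : finrank F V = 2 * k + 1) (U : ι → Submodule F V) (hU : ∀ i, finrank F (U i) = k)
    (hdisj : Pairwise fun i j => Disjoint (U i) (U j)) :
    Nat.card ι ≤ Nat.card F ^ (k + 1) + 1 := by
  classical
  have := Fintype.ofFinite ι
  by_contra! hcard
  rw [Nat.card_eq_fintype_card (α := ι)] at hcard
  have : Finite (Dual F V) := Module.finite_of_finite F
  have : Fintype (Dual F V) := Fintype.ofFinite _
  -- Nonzero functionals stand for hyperplanes, each being the kernel of `q - 1` of them.
  let S : Finset (Dual F V) := Finset.univ.erase 0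
  have hS : S.card = Nat.card F ^ (2 * k + 1) - 1 := by
    rw [← hV, ← Subspace.dual_finrank_eq, ← Module.natCard_eq_pow_finrank,
      Nat.card_eq_fintype_card, ← Finset.card_univ]
    exact Finset.card_erase_of_mem (Finset.mem_univ _)
  have habove : ∀ i, (S.filter fun f => U i ≤ LinearMap.ker f).card
      = Nat.card F ^ (k + 1) - 1 := fun i => by
    have h1 := Subspace.finrank_add_finrank_dualAnnihilator_eq (U i)
    rw [hU, hV] at h1
    rw [show k + 1 = finrank F (U i).dualAnnihilator by omega,
      ← Submodule.natCard_ne_zero_subtype, Nat.card_eq_fintype_card, ← Fintype.card_coe]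
    refine Fintype.card_congr
      { toFun := fun f => ⟨⟨f.1, ?_⟩, ?_⟩
        invFun := fun f => ⟨f.1.1, ?_⟩
        left_inv := fun f => rfl
        right_inv := fun f => rfl }
    · have := (Finset.mem_filter.1 f.2).2
      exact (Submodule.mem_dualAnnihilator _).2 fun w hw => this hw
    · have := Finset.ne_of_mem_erase (Finset.mem_filter.1 f.2).1
      exact fun h => this (congrArg Subtype.val h)
    · refine Finset.mem_filter.2 ⟨Finset.mem_erase.2 ⟨?_, Finset.mem_univ _⟩, ?_⟩
      · exact fun h => f.2 (Subtype.ext h)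
      · exact fun w hw => (Submodule.mem_dualAnnihilator _).1 f.1.2 w hw
  have hbelow : ∀ f ∈ S, (Finset.univ.filter fun i => U i ≤ LinearMap.ker f).card
      ≤ Nat.card F := fun f hf => by
    refine card_filter_le_hyperplane hk hV U hU hdisj hcard _ ?_
    have := Module.Dual.finrank_ker_add_one_of_ne_zero (Finset.ne_of_mem_erase hf)
    omega
  have hdc := Finset.sum_card_bipartiteAbove_eq_sum_card_bipartiteBelow
    (s := (Finset.univ : Finset ι)) (t := S) fun i f => U i ≤ LinearMap.ker f
  simp only [Finset.bipartiteAbove, Finset.bipartiteBelow, habove, Finset.sum_const,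
    Finset.card_univ, smul_eq_mul] at hdc
  have h := hdc.trans_le (Finset.sum_le_sum hbelow)
  simp only [Finset.sum_const, smul_eq_mul, hS] at h
  have hq1 : 1 < Nat.card F := Finite.one_lt_card
  have hq2 : 1 < Nat.card F ^ (k + 1) := Nat.one_lt_pow (by omega) hq1
  have e : Nat.card F ^ (k + 1) * Nat.card F ^ (k + 1)
    = Nat.card F ^ (2 * k + 1) * Nat.card F := by ring
  have hq3 : 1 ≤ Nat.card F ^ (2 * k + 1) := Nat.one_le_pow _ _ (by omega)
  clear habove hdc hbelow hS
  generalize Nat.card F ^ (2 * k + 1) = Y at *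
  generalize Nat.card F ^ (k + 1) = X at *
  generalize Nat.card F = q at *
  obtain ⟨x, rfl⟩ : ∃ x, X = x + 2 := ⟨X - 2, by omega⟩
  obtain ⟨y, rfl⟩ : ∃ y, Y = y + 1 := ⟨Y - 1, by omega⟩
  -- With `X = q ^ (k + 1)`, the double count gives `(X + 2)(X - 1) ≤ X² - q`, that is `X + q ≤ 2`,
  -- which is absurd.
  rw [show x + 2 - 1 = x + 1 by omega, Nat.add_sub_cancel] at h
  have h2 := (Nat.mul_le_mul_right (x + 1) hcard).trans h
  nlinarith

end Counting

/-! ### Optimal codes from a field extension -/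

section Construction

theorem exists_finite_field_extension (F : Type*) [Field F] [Finite F] {n : ℕ} (hn : 1 ≤ n) :
    ∃ (K : Type) (_ : Field K) (_ : Finite K) (_ : Algebra F K), finrank F K = n := by
  have : NeZero n := ⟨by omega⟩
  obtain ⟨p, hp⟩ := CharP.exists F
  have : Fact p.Prime := ⟨CharP.char_is_prime F p⟩
  exact ⟨FiniteField.Extension F p n, inferInstance, inferInstance, inferInstance,
    FiniteField.finrank_extension F p n⟩

variable {F V : Type*} [Field F] [AddCommGroup V] [Module F V]

theorem pairwise_option_of_symm {α : Type*} {r : Option α → Option α → Prop}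
    (hr : ∀ a b, r a b → r b a) (hs : ∀ a b : α, a ≠ b → r (some a) (some b))
    (hn : ∀ a : α, r (some a) none) : Pairwise r := by
  rintro (- | a) (- | b) hab
  · exact absurd rfl hab
  · exact hr _ _ (hn b)
  · exact hn a
  · exact hs a b fun h => hab (h ▸ rfl)

/-- The construction of `card_mem_flagCodeSizes` in an arbitrary space of dimension `v`. -/
theorem natCard_mem_flagCodeSizes [FiniteDimensional F V] {ι : Type*} [Finite ι] {v : ℕ}
    (hv : 2 ≤ v) (hV : finrank F V = v)
    (U X : ι → Submodule F V) (hUX : ∀ a, U a ≤ X a) {k : ℕ}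
    (hU : ∀ a, finrank F (U a) = k) (hX : ∀ a, finrank F (X a) ≤ k + 1) (hkv : v ≤ 2 * k + 1)
    (hkv' : 2 * k ≤ v)
    (hdisj : Pairwise fun a b => Disjoint (U a) (U b))
    (hcodisj : Pairwise fun a b => Codisjoint (X a) (X b)) :
    Nat.card ι ∈ flagCodeSizes F v (∑ i ∈ Finset.range (v + 1), min i (v - i))
      (Finset.Ico 1 v) := by
  let e : V ≃ₗ[F] (Fin v → F) := LinearEquiv.ofFinrankEq _ _ (by rw [hV, finrank_fin_fun])
  let φ := Submodule.orderIsoMapComap e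
  have hφ : ∀ A : Submodule F V, finrank F (φ A) = finrank F A := fun A =>
    LinearEquiv.finrank_map_eq e A
  exact card_mem_flagCodeSizes hv (fun a => φ (U a)) (fun a => φ (X a))
    (fun a => φ.monotone (hUX a)) (fun a => (hφ _).trans (hU a)) (fun a => (hφ _).trans_le (hX a))
    hkv hkv' (fun a b hab => (hdisj hab).map_orderIso φ)
    (fun a b hab => (hcodisj hab).map_orderIso φ)

theorem card_add_one_mem_flagCodeSizes_even (F : Type*) [Field F] [Finite F] {k : ℕ}
    (hk : 1 ≤ k) : Nat.card F ^ k + 1 ∈ flagCodeSizes F (2 * k) (k ^ 2) (Finset.Ico 1 (2 * k)) := by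
  obtain ⟨K, _, _, _, hK⟩ := exists_finite_field_extension F hk
  have : FiniteDimensional F K := .of_finite
  have hcard : Nat.card (Option K) = Nat.card F ^ k + 1 := by
    rw [Finite.card_option, Module.natCard_eq_pow_finrank (K := F) (V := K), hK]
  have hVK : finrank F (K × K) = 2 * k := by
    rw [finrank_prod, hK]
    ring
  -- The lines through the origin of the plane `K × K`: slope `a`, or vertical for `none`.
  let U : Option K → Submodule F (K × K)
    | none => LinearMap.range (LinearMap.inr F K K)
    | some a => LinearMap.range (LinearMap.prod LinearMap.id (LinearMap.mulLeft F a))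
  have hU : ∀ a, finrank F (U a) = k := by
    rintro (- | a)
    · exact (LinearMap.finrank_range_of_inj LinearMap.inr_injective).trans hK
    · refine (LinearMap.finrank_range_of_inj fun x y h => ?_).trans hK
      exact congrArg Prod.fst h
  have hdisj : Pairwise fun a b => Disjoint (U a) (U b) := by
    refine pairwise_option_of_symm (fun a b h => h.symm) (fun a b hab => ?_) fun a => ?_ <;>
    rw [Submodule.disjoint_def]
    · rintro _ ⟨x, rfl⟩ ⟨y, hy⟩
      have h1 : y = x := congrArg Prod.fst hy
      have h2 : b * y = a * x := congrArg Prod.snd hy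
      subst h1
      have : y = 0 := by
        by_contra hy0
        exact hab (mul_right_cancel₀ hy0 h2).symm
      simp [this]
    · rintro _ ⟨x, rfl⟩ ⟨y, hy⟩
      have h1 : (0 : K) = x := congrArg Prod.fst hy
      simp [← h1]
  have h := natCard_mem_flagCodeSizes (by omega) hVK U U (fun _ => le_rfl) hU
    (fun a => by rw [hU]; omega) (by omega) le_rfl hdisj fun a b hab => by
      refine codisjoint_iff.2 ?_
      refine Submodule.eq_top_of_disjoint _ _ ?_ (hdisj hab)
      rw [hU, hU, hVK]
      omega
  rwa [sum_min_sub_even, hcard] at h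

theorem card_add_one_mem_flagCodeSizes_odd (F : Type*) [Field F] [Finite F] {k : ℕ}
    (hk : 1 ≤ k) : Nat.card F ^ (k + 1) + 1 ∈
      flagCodeSizes F (2 * k + 1) (k ^ 2 + k) (Finset.Ico 1 (2 * k + 1)) := by
  obtain ⟨K, _, _, _, hK⟩ := exists_finite_field_extension F (Nat.le_add_left 1 k)
  have : FiniteDimensional F K := .of_finite
  classical
  have hcard : Nat.card (Option K) = Nat.card F ^ (k + 1) + 1 := by
    rw [Finite.card_option, Module.natCard_eq_pow_finrank (K := F) (V := K), hK]
  obtain ⟨T, hT⟩ := Submodule.exists_isCompl (F ∙ (1 : K))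
  have hTk : finrank F T = k := by
    have := Submodule.finrank_add_eq_of_isCompl hT
    rw [finrank_span_singleton one_ne_zero, hK] at this
    omega
  have hdecomp : ∀ z : K, ∃ (t : T) (c : F), z = t + c • 1 := fun z => by
    have hz : z ∈ (F ∙ (1 : K)) ⊔ T := by
      rw [hT.sup_eq_top]
      trivial
    obtain ⟨y, hy, t, ht, rfl⟩ := Submodule.mem_sup.1 hz
    obtain ⟨c, rfl⟩ := Submodule.mem_span_singleton.1 hy
    exact ⟨⟨t, ht⟩, c, add_comm _ _⟩
  have hVK : finrank F (T × K) = 2 * k + 1 := by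
    rw [finrank_prod, hK, hTk]
    ring
  -- `g a` is the vector that enlarges `U (some a)` to `X (some a)`. Taking `a` itself would add
  -- nothing at `a = 0`, hence the 1 there; codisjointness only needs `a - b` to lie in the span of
  -- `g a` and `g b`.
  let g : K → K := fun a => if a = 0 then 1 else a
  have hg : ∀ a, g a ≠ 0 := fun a => by
    by_cases h : a = 0 <;> simp [g, h]
  have hgg : ∀ a b, a ≠ b → ∃ s s' : F, s • g a + s' • g b = a - b := fun a b hab => by
    by_cases ha : a = 0
    · have hb : b ≠ 0 := fun h => hab (ha.trans h.symm)
      exact ⟨0, -1, by simp [g, ha, hb]⟩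
    · by_cases hb : b = 0
      · exact ⟨1, 0, by simp [g, ha, hb]⟩
      · exact ⟨1, -1, by simp [g, ha, hb, sub_eq_add_neg]⟩
  let fU : K → T →ₗ[F] T × K := fun a =>
    LinearMap.prod LinearMap.id (LinearMap.mulLeft F a ∘ₗ T.subtype)
  let fX : K → T × F →ₗ[F] T × K := fun a =>
    LinearMap.coprod (fU a) (LinearMap.inr F T K ∘ₗ LinearMap.toSpanSingleton F K (g a))
  have hfX : ∀ a t s, fX a (t, s) = (t, a * (t : K) + s • g a) := fun a t s => by
    simp [fX, fU]
  let U : Option K → Submodule F (T × K)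
    | none => LinearMap.range (LinearMap.inr F T K ∘ₗ T.subtype)
    | some a => LinearMap.range (fU a)
  let X : Option K → Submodule F (T × K)
    | none => LinearMap.range (LinearMap.inr F T K)
    | some a => LinearMap.range (fX a)
  have hUX : ∀ a, U a ≤ X a := by
    rintro (- | a)
    · exact LinearMap.range_comp_le_range _ _
    · rintro _ ⟨x, rfl⟩
      exact ⟨(x, 0), by simp [fX]⟩
  have hU : ∀ a, finrank F (U a) = k := by
    rintro (- | a)
    · refine (LinearMap.finrank_range_of_inj fun x y h => ?_).trans hTk
      exact Subtype.ext (congrArg Prod.snd h)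
    · exact (LinearMap.finrank_range_of_inj fun x y h => congrArg Prod.fst h).trans hTk
  have hX : ∀ a, finrank F (X a) ≤ k + 1 := by
    rintro (- | a)
    · exact (LinearMap.finrank_range_le _).trans hK.le
    · refine (LinearMap.finrank_range_le _).trans ?_
      rw [finrank_prod, hTk, finrank_self]
  have hdisj : Pairwise fun a b => Disjoint (U a) (U b) := by
    refine pairwise_option_of_symm (fun a b h => h.symm) (fun a b hab => ?_) fun a => ?_ <;>
    rw [Submodule.disjoint_def]
    · rintro _ ⟨x, rfl⟩ ⟨y, hy⟩
      have h1 : y = x := congrArg Prod.fst hy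
      have h2 : b * (y : K) = a * x := congrArg Prod.snd hy
      subst h1
      have : y = 0 := by
        by_contra hy0
        exact hab (mul_right_cancel₀ (fun h => hy0 (Subtype.ext h)) h2).symm
      simp [this]
    · rintro _ ⟨x, rfl⟩ ⟨y, hy⟩
      have h1 : 0 = x := congrArg Prod.fst hy
      simp [← h1]
  have hcodisj : Pairwise fun a b => Codisjoint (X a) (X b) := by
    refine pairwise_option_of_symm (fun a b h => h.symm) (fun a b hab => ?_) fun a => ?_ <;>
    rw [codisjoint_iff, Submodule.eq_top_iff'] <;> rintro ⟨t, y⟩ <;> rw [Submodule.mem_sup]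
    · have hab' : a - b ≠ 0 := sub_ne_zero.2 hab
      -- The equation to solve is `a x + b (t - x) + c (a - b) = y`, that is `x + c = (y - b t) / (a
      -- - b)`; it is solvable because `K = T ⊕ F`.
      obtain ⟨x, c, hxc⟩ := hdecomp ((y - b * t) / (a - b))
      obtain ⟨s, s', hs⟩ := hgg a b hab
      rw [div_eq_iff hab'] at hxc
      refine ⟨_, ⟨(x, c * s), rfl⟩, _, ⟨(t - x, c * s'), rfl⟩, ?_⟩
      rw [hfX, hfX]
      refine Prod.ext (add_sub_cancel x t) ?_
      have hs2 : (c * s) • g a + (c * s') • g b = c • (a - b) := by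
        rw [← hs, smul_add, mul_smul, mul_smul]
      rw [add_mul, smul_mul_assoc, one_mul, ← hs2] at hxc
      simp only [Prod.snd_add, AddSubgroupClass.coe_sub]
      linear_combination -hxc
    · refine ⟨_, ⟨(t, 0), rfl⟩, _, ⟨y - a * t, rfl⟩, ?_⟩
      rw [hfX]
      simp
  have h := natCard_mem_flagCodeSizes (by omega) hVK U X hUX hU hX le_rfl (by omega) hdisj hcodisj
  rwa [sum_min_sub_odd, hcard] at h

end Construction

/-! ### From flag codes to partial spreads -/

section Bounds

universe u

/-- The members of dimension `k` of a full flag code at the maximum distance form a partial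
spread. -/
theorem exists_pairwise_disjoint_of_mem_flagCodeSizes {F : Type u} [Field F] [Finite F]
    {v n k : ℕ}
    (hn : n ∈ flagCodeSizes F v (∑ i ∈ Finset.range (v + 1), min i (v - i)) (Finset.Ico 1 v))
    (hk : 1 ≤ k) (hkv : 2 * k ≤ v) :
    ∃ (ι : Type u) (_ : Finite ι) (U : ι → Submodule F (Fin v → F)), Nat.card ι = n ∧
      (∀ a, finrank F (U a) = k) ∧ Pairwise fun a b => Disjoint (U a) (U b) := by
  obtain ⟨C, hC, hd, rfl⟩ := hn
  have := finite_vflag F v (Finset.Ico 1 v).card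
  let j : Fin (Finset.Ico 1 v).card := ⟨k - 1, by rw [Nat.card_Ico]; omega⟩
  have hj : (j : ℕ) + 1 = k := Nat.sub_add_cancel hk
  refine ⟨C, inferInstance, fun L => L.1.W j, rfl, fun L => ?_, fun L L' hne => ?_⟩
  · rw [VFlag.finrank_eq_of_mem_flagsOfType (hC L.2), hj]
  · refine VFlag.disjoint_of_le_grassmannDist (hC L.2) (hC L'.2) ?_ j (by omega)
    have h := hd.trans ((iInf₂_le L.1 L.2).trans ((iInf₂_le L'.1 L'.2).trans
      (iInf_le _ fun h => hne (Subtype.ext h))))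
    exact_mod_cast h

end Bounds

theorem mainTheorem1 (q : ℕ) (F : Type*) [Field F] [Finite F] (hq : Nat.card F = q) :
    (∀ k : ℕ, 1 ≤ k → maxFullFlagCode F (2 * k) (k ^ 2) = q ^ k + 1) ∧
    (∀ k : ℕ, 2 ≤ k → maxFullFlagCode F (2 * k + 1) (k ^ 2 + k) = q ^ (k + 1) + 1) := by
  subst hq
  refine ⟨fun k hk => ?_, fun k hk => ?_⟩ <;>
  refine (isGreatest_maxFlagCode F _ _ _).unique ⟨?_, fun n hn => ?_⟩
  · exact card_add_one_mem_flagCodeSizes_even F hk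
  · rw [← sum_min_sub_even] at hn
    obtain ⟨ι, _, U, rfl, hU, hdisj⟩ :=
      exists_pairwise_disjoint_of_mem_flagCodeSizes hn hk le_rfl
    exact natCard_le_of_pairwise_disjoint_even hk (finrank_fin_fun F) U hU hdisj
  · exact card_add_one_mem_flagCodeSizes_odd F (by omega)
  · rw [← sum_min_sub_odd] at hn
    obtain ⟨ι, _, U, rfl, hU, hdisj⟩ :=
      exists_pairwise_disjoint_of_mem_flagCodeSizes (k := k) hn (by omega) (by omega)
    exact natCard_le_of_pairwise_disjoint_odd hk (finrank_fin_fun F) U hU hdisj
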